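/- Let $n,w\ge 0$ be integers such that $n-2w$ is a triangular number $m(m+1)/2$ with $m\ge 0$. A strict partition is a partition with pairwise distinct parts. A partition has $2$-weight $w$ if one arrives at a $2$-core (a partition from whose Young diagram no rim hook of length $2$ can be removed) by successively removing $w$ rim hooks of length $2$ from its Young diagram. The H-abacus has the positive integers as its positions, arranged from top to bottom on three runners: $2,4,6,8,\dots$ (the leftmost runner), $1,5,9,\dots$ and $3,7,11,\dots$. A strict partition is represented by one bead at the position of each of its parts; two beads may never occupy the same position. The following moves are allowed, with the indicated H-weights: 1. move a bead one position up along the leftmost runner, to an unoccupied position (H-weight $1$); 2. remove a bead at position $2$ (H-weight $1$); 3. move a bead one position up along the runner of $1$ or the runner of $3$, to an unoccupied position (H-weight $2$); 4. remove the two beads at positions $1$ and $3$ simultaneously (H-weight $2$). An H-core is a configuration in which no move is possible. A strict partition has H-weight $w$ if moves of total H-weight $w$ lead from it to an H-core. Let $SP(n)_w$ be the set of strict partitions of $n$ with $2$-weight $w$, let $SP(n)^w$ be the set of strict partitions of $n$ with H-weight $w$, and let $p(w)$ be the number of partitions of $w$. Then $$|SP(n)_w| = |SP(n)^w| = p(w).$$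 -/

import Mathlib

/-- The Young diagram of a partition: its rows are the parts in weakly decreasing order. -/
def Nat.Partition.youngDiagram {n : ℕ} (p : n.Partition) : YoungDiagram :=
  YoungDiagram.ofRowLens (p.parts.sort (· ≥ ·)) (Multiset.pairwise_sort p.parts (· ≥ ·)).sortedGE

/-- `RemovesTwoHook μ ν`: the Young diagram `ν` arises from `μ` by removing a rim hook of
length two, that is, two horizontally or vertically adjacent cells. -/
def RemovesTwoHook (μ ν : YoungDiagram) : Prop :=
  ν ≤ μ ∧ ∃ i j : ℕ,
    μ.cells \ ν.cells = {(i, j), (i, j + 1)} ∨ μ.cells \ ν.cells = {(i, j), (i + 1, j)}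

/-- `TwoHookReduces μ ν w`: `ν` arises from `μ` by successively removing `w` rim 2-hooks. -/
inductive TwoHookReduces : YoungDiagram → YoungDiagram → ℕ → Prop
  | refl (μ : YoungDiagram) : TwoHookReduces μ μ 0
  | step {μ ν ρ : YoungDiagram} {w : ℕ} :
      RemovesTwoHook μ ν → TwoHookReduces ν ρ w → TwoHookReduces μ ρ (w + 1)

/-- A 2-core: no rim 2-hook can be removed. -/
def IsTwoCore (μ : YoungDiagram) : Prop :=
  ∀ ν : YoungDiagram, ¬ RemovesTwoHook μ ν

/-- The partition `p` has 2-weight `w`: one reaches a 2-core by removing `w` rim 2-hooks. -/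
def Nat.Partition.HasTwoWeight {n : ℕ} (p : n.Partition) (w : ℕ) : Prop :=
  ∃ c : YoungDiagram, TwoHookReduces p.youngDiagram c w ∧ IsTwoCore c

/-- One move on the H-abacus, with its H-weight. The positions are the positive integers,
arranged on the runners `2, 4, 6, …` (the leftmost one), `1, 5, 9, …` and `3, 7, 11, …`;
a configuration is the finite set of positions that carry a bead, so that no two beads
share a position. -/
inductive HMove : Finset ℕ → Finset ℕ → ℕ → Prop
  /-- Move a bead one position up along the leftmost runner. -/
  | evenUp (S : Finset ℕ) (a : ℕ) (h0 : 0 < a) (ha : Even a) (hs : a + 2 ∈ S) (hf : a ∉ S) :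
      HMove S (insert a (S.erase (a + 2))) 1
  /-- Remove a bead at the position 2. -/
  | removeTwo (S : Finset ℕ) (hs : 2 ∈ S) : HMove S (S.erase 2) 1
  /-- Move a bead one position up along the runner of 1 or of 3. -/
  | oddUp (S : Finset ℕ) (a : ℕ) (ha : Odd a) (hs : a + 4 ∈ S) (hf : a ∉ S) :
      HMove S (insert a (S.erase (a + 4))) 2
  /-- Remove the two beads at the positions 1 and 3 simultaneously. -/
  | removePair (S : Finset ℕ) (h1 : 1 ∈ S) (h3 : 3 ∈ S) : HMove S ((S.erase 1).erase 3) 2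

/-- `HReduces S T w`: a sequence of moves of total H-weight `w` leads from `S` to `T`. -/
inductive HReduces : Finset ℕ → Finset ℕ → ℕ → Prop
  | refl (S : Finset ℕ) : HReduces S S 0
  | step {S T U : Finset ℕ} {k w : ℕ} : HMove S T k → HReduces T U w → HReduces S U (k + w)

/-- An H-core: a configuration of beads in which no move is possible. -/
def IsHCore (S : Finset ℕ) : Prop :=
  ∀ (T : Finset ℕ) (k : ℕ), ¬ HMove S T k

/-- The H-abacus of a strict partition: one bead at the position of each part. -/
def Nat.Partition.hAbacus {n : ℕ} (p : n.Partition) : Finset ℕ :=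
  p.parts.toFinset

/-- The strict partition `p` has H-weight `w`: moves of total H-weight `w` lead from its
H-abacus to an H-core. -/
def Nat.Partition.HasHWeight {n : ℕ} (p : n.Partition) (w : ℕ) : Prop :=
  ∃ C : Finset ℕ, HReduces p.hAbacus C w ∧ IsHCore C

/-- The strict partitions of `n` with 2-weight `w`. -/
def strictTwoWeight (n w : ℕ) : Set n.Partition :=
  {p | p ∈ Nat.Partition.distincts n ∧ p.HasTwoWeight w}

/-- The strict partitions of `n` with H-weight `w`. -/
def strictHWeight (n w : ℕ) : Set n.Partition :=
  {p | p ∈ Nat.Partition.distincts n ∧ p.HasHWeight w}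

/-!
Both weights are read off from an integer statistic, and the two statistics have generating
functions that are Gaussian binomial coefficients.

*Weights.* The colour sum of a Young diagram, the sum of `(-1) ^ (i + j)` over its cells `(i, j)`,
does not change when a rim 2-hook is removed. A 2-core is a staircase, and a staircase of colour sum
`d` has `d * (2 * d - 1)` cells. Since `d ↦ d * (2 * d - 1)` runs through the triangular numbers
without repetition as `d` runs through the integers, a partition of `d * (2 * d - 1) + 2 * w` has
2-weight `w` if and only if its colour sum is `d` (`Nat.Partition.hasTwoWeight_iff`). In the same
way the charge of a bead configuration, the number of beads on the runner of `1` minus that on the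
runner of `3`, is invariant under the moves on the H-abacus; an H-core of charge `d` has sum
`d * (2 * d - 1)`; and H-weight `w` means charge `d` (`Nat.Partition.hasHWeight_iff`).

*Counting by colour sum.* For a strict partition with parts `x₀ > x₁ > ⋯` the colour sum is the
alternating sum of the parities of the parts. Adding a new largest part `N` changes the statistic
`d` into `(N mod 2) - d`, so the generating functions of the strict partitions with parts at most
`N` and statistic `d` satisfy a recursion in `N`. Up to the factor `X ^ (d * (2 * d - 1))` it is
one of the two Pascal rules for Gaussian binomial coefficients at `X ^ 2`, according to the parity
of `N` (`subsetGF_altStat`). For large `N` the coefficient of `X ^ (2 * w)` of the Gaussian binomial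
coefficient is `p(w)`.

*Counting by charge.* The even parts contribute `∏ (1 + X ^ (2 * i))`. The odd parts, taken in the
order `1, 3, 5, …`, satisfy the Pascal rules at `X ^ 4`: a finite form of Jacobi's triple product
(`subsetGF_charge_odd`). In the limit this gives, with `Y = X ^ 2`, the series
`∏ (1 + Y ^ i) / ∏ (1 - Y ^ (2 * i)) = ∏ 1 / (1 - Y ^ i)`, with coefficients `p(w)` again.
-/

/-! ### Gaussian binomial coefficients -/

/-- The Gaussian binomial coefficient `[a + b choose a]` at `q`, the generating function of the
partitions that fit into an `a × b` box, defined by one of its two Pascal rules. -/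
def gaussBinom {R : Type*} [CommRing R] (q : R) : ℕ → ℕ → R
  | 0, _ => 1
  | _ + 1, 0 => 1
  | a + 1, b + 1 => gaussBinom q (a + 1) b + q ^ (b + 1) * gaussBinom q a (b + 1)
termination_by a b => a + b

section gaussBinom

variable {R : Type*} [CommRing R] (q : R)

@[simp]
lemma gaussBinom_zero_left (b : ℕ) : gaussBinom q 0 b = 1 := by
  rw [gaussBinom]

@[simp]
lemma gaussBinom_zero_right (a : ℕ) : gaussBinom q a 0 = 1 := by
  cases a <;> rw [gaussBinom]

lemma gaussBinom_succ_succ (a b : ℕ) : gaussBinom q (a + 1) (b + 1) =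
    gaussBinom q (a + 1) b + q ^ (b + 1) * gaussBinom q a (b + 1) := by
  rw [gaussBinom]

/-- The second Pascal rule, in which the roles of the two sides of the box are exchanged. -/
lemma gaussBinom_succ_succ' (a b : ℕ) : gaussBinom q (a + 1) (b + 1) =
    gaussBinom q a (b + 1) + q ^ (a + 1) * gaussBinom q (a + 1) b := by
  induction h : a + b using Nat.strong_induction_on generalizing a b with
  | _ n ih =>
    subst h
    rw [gaussBinom_succ_succ]
    rcases a with _ | a <;> rcases b with _ | b
    · simp
    · rw [ih b (by omega) 0 b (by omega)]
      have := gaussBinom_succ_succ q 0 b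
      rw [ih b (by omega) 0 b (by omega)] at this
      simp only [gaussBinom_zero_left] at this ⊢
      linear_combination (-q) * this
    · have := ih (a + 0) (by omega) a 0 rfl
      rw [gaussBinom_succ_succ] at this ⊢
      simp only [gaussBinom_zero_right] at this ⊢
      linear_combination q * this
    · linear_combination ih (a + 1 + b) (by omega) (a + 1) b rfl +
        q ^ (b + 2) * ih (a + (b + 1)) (by omega) a (b + 1) rfl -
        gaussBinom_succ_succ q a (b + 1) - q ^ (a + 2) * gaussBinom_succ_succ q (a + 1) b

lemma gaussBinom_comm (a b : ℕ) : gaussBinom q a b = gaussBinom q b a := by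
  induction h : a + b using Nat.strong_induction_on generalizing a b with
  | _ n ih =>
    subst h
    rcases a with _ | a <;> rcases b with _ | b
    · simp
    · simp
    · simp
    · rw [gaussBinom_succ_succ, gaussBinom_succ_succ', ih _ (by omega) (a + 1) b rfl,
        ih _ (by omega) a (b + 1) rfl]

/-- The product formula, cleared of denominators. -/
lemma gaussBinom_mul_prod (a b : ℕ) :
    gaussBinom q a b * ∏ i ∈ Finset.range a, (1 - q ^ (i + 1)) =
      ∏ i ∈ Finset.range a, (1 - q ^ (b + i + 1)) := by
  induction h : a + b using Nat.strong_induction_on generalizing a b with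
  | _ n ih =>
    subst h
    rcases a with _ | a
    · simp
    rcases b with _ | b
    · simp
    have h1 := ih _ (by omega) (a + 1) b rfl
    have h2 := ih _ (by omega) a (b + 1) rfl
    rw [Finset.prod_range_succ' (fun i => 1 - q ^ (b + i + 1))] at h1
    have h3 : ∏ i ∈ Finset.range a, (1 - q ^ (b + (i + 1) + 1)) =
        ∏ i ∈ Finset.range a, (1 - q ^ (b + 1 + i + 1)) :=
      Finset.prod_congr rfl fun i _ => by rw [show b + (i + 1) + 1 = b + 1 + i + 1 by ring]
    rw [h3] at h1
    rw [gaussBinom_succ_succ, add_mul, h1, Finset.prod_range_succ, Finset.prod_range_succ]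
    linear_combination q ^ (b + 1) * (1 - q ^ (a + 1)) * h2

lemma map_gaussBinom {S : Type*} [CommRing S] (f : R →+* S) (a b : ℕ) :
    f (gaussBinom q a b) = gaussBinom (f q) a b := by
  induction h : a + b using Nat.strong_induction_on generalizing a b with
  | _ n ih =>
    subst h
    rcases a with _ | a <;> rcases b with _ | b
    · simp
    · simp
    · simp
    · rw [gaussBinom_succ_succ, gaussBinom_succ_succ, map_add, map_mul, map_pow,
        ih _ (by omega) (a + 1) b rfl, ih _ (by omega) a (b + 1) rfl]

/-- The Gaussian binomial coefficient `[a + b choose a]` for integers `a` and `b`, which is zero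
unless both are nonnegative. -/
def gaussBinomInt (a b : ℤ) : R :=
  if 0 ≤ a ∧ 0 ≤ b then gaussBinom q a.toNat b.toNat else 0

lemma gaussBinomInt_natCast (a b : ℕ) : gaussBinomInt q a b = gaussBinom q a b := by
  simp [gaussBinomInt]

lemma gaussBinomInt_of_neg {a b : ℤ} (h : a < 0 ∨ b < 0) : gaussBinomInt q a b = 0 := by
  rw [gaussBinomInt, if_neg (by omega)]

lemma gaussBinomInt_comm (a b : ℤ) : gaussBinomInt q a b = gaussBinomInt q b a := by
  simp only [gaussBinomInt, gaussBinom_comm q a.toNat, and_comm]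

/-- The Pascal rule, edges of the quadrant included. It fails at the origin, which `a + b ≠ 0`
excludes. -/
lemma gaussBinomInt_pascal {a b : ℤ} (h : a + b ≠ 0) : gaussBinomInt q a b =
    gaussBinomInt q a (b - 1) + q ^ b.toNat * gaussBinomInt q (a - 1) b := by
  rcases lt_or_ge a 0 with ha | ha
  · simp [gaussBinomInt_of_neg q (Or.inl ha),
      gaussBinomInt_of_neg q (Or.inl (show a - 1 < 0 by omega))]
  rcases lt_or_ge b 0 with hb | hb
  · simp [gaussBinomInt_of_neg q (Or.inr hb),
      gaussBinomInt_of_neg q (Or.inr (show b - 1 < 0 by omega))]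
  lift a to ℕ using ha
  lift b to ℕ using hb
  rcases a with _ | a <;> rcases b with _ | b
  · simp at h
  · have h1 : ((b + 1 : ℕ) : ℤ) - 1 = (b : ℕ) := by push_cast; ring
    rw [h1, gaussBinomInt_of_neg q (a := ((0 : ℕ) : ℤ) - 1) (by simp)]
    simp only [gaussBinomInt_natCast, gaussBinom_zero_left]
    simp
  · have h1 : ((a + 1 : ℕ) : ℤ) - 1 = (a : ℕ) := by push_cast; ring
    rw [h1, gaussBinomInt_of_neg q (b := ((0 : ℕ) : ℤ) - 1) (by simp)]
    simp only [gaussBinomInt_natCast, gaussBinom_zero_right]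
    simp
  · have h1 : ((a + 1 : ℕ) : ℤ) - 1 = (a : ℕ) := by push_cast; ring
    have h2 : ((b + 1 : ℕ) : ℤ) - 1 = (b : ℕ) := by push_cast; ring
    rw [h1, h2]
    simp only [gaussBinomInt_natCast, Int.toNat_natCast]
    exact gaussBinom_succ_succ q a b

end gaussBinom

/-! ### Partition numbers as limits of Gaussian binomial coefficients -/

open PowerSeries PowerSeries.WithPiTopology in
/-- The generating function of the partitions into parts at most `M`. -/
lemma powerSeriesMk_card_restricted_mul_prod (M : ℕ) :
    (PowerSeries.mk fun n => ((Nat.Partition.restricted n (· ≤ M)).card : ℤ)) *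
      ∏ i ∈ Finset.range M, (1 - (X : ℤ⟦X⟧) ^ (i + 1)) = 1 := by
  let _ : TopologicalSpace ℤ := ⊥
  have _ : DiscreteTopology ℤ := ⟨rfl⟩
  rw [Nat.Partition.powerSeriesMk_card_restricted_eq_tprod ℤ (· ≤ M),
    tprod_eq_prod (s := Finset.range M) (fun i hi => if_neg (by simpa using hi)),
    ← Finset.prod_mul_distrib]
  refine Finset.prod_eq_one fun i hi => ?_
  rw [if_pos (by simpa using hi)]
  simp_rw [pow_mul]
  exact tsum_pow_mul_one_sub_of_constantCoeff_eq_zero (f := (X : ℤ⟦X⟧) ^ (i + 1))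
    (by rw [map_pow, constantCoeff_X, zero_pow i.succ_ne_zero])

open PowerSeries in
/-- A power series that inverts `∏ (1 - X ^ i)` up to order `w` has the partition number `p(w)` as
its coefficient of `X ^ w`. -/
lemma coeff_eq_card_partition {w M : ℕ} (hM : w ≤ M) (f : ℤ⟦X⟧)
    (hf : X ^ (w + 1) ∣ f * ∏ i ∈ Finset.range M, (1 - X ^ (i + 1)) - 1) :
    coeff w f = Fintype.card w.Partition := by
  have h := powerSeriesMk_card_restricted_mul_prod M
  set r : ℤ⟦X⟧ := PowerSeries.mk fun n => ((Nat.Partition.restricted n (· ≤ M)).card : ℤ) with hr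
  have h1 : X ^ (w + 1) ∣ f - r := by
    convert! hf.mul_right r using 1
    linear_combination (-f) * h
  have h2 := X_pow_dvd_iff.mp h1 w (by omega)
  rw [map_sub, sub_eq_zero] at h2
  rw [h2, hr, coeff_mk, Nat.Partition.restricted, Finset.filter_true_of_mem, Finset.card_univ]
  exact fun p _ i hi => (Nat.Partition.le_of_mem_parts hi).trans hM

lemma dvd_prod_one_sub_pow_sub_one {R : Type*} [CommRing R] (q x : R) (a b : ℕ)
    (h : x ∣ q ^ (b + 1)) :
    x ∣ ∏ i ∈ Finset.range a, (1 - q ^ (b + i + 1)) - 1 := by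
  induction a with
  | zero => simp
  | succ a ih =>
    rw [Finset.prod_range_succ]
    have h1 : x ∣ q ^ (b + a + 1) := h.trans (pow_dvd_pow q (by omega))
    have := ih.sub (h1.mul_left (∏ i ∈ Finset.range a, (1 - q ^ (b + i + 1))))
    convert! this using 1
    ring

open PowerSeries in
lemma coeff_gaussBinom_X {w a b : ℕ} (ha : w ≤ a) (hb : w ≤ b) :
    coeff w (gaussBinom (X : ℤ⟦X⟧) a b) = Fintype.card w.Partition := by
  refine coeff_eq_card_partition ha _ ?_
  rw [gaussBinom_mul_prod]
  exact dvd_prod_one_sub_pow_sub_one _ _ _ _ (pow_dvd_pow X (by omega))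

open PowerSeries in
/-- Writing each multiplicity of a partition as its remainder modulo 2 plus an even number gives
`p(w)` as the sum, over `i + 2 * j = w`, of the number of strict partitions of `i` times `p(j)`.
For the series, `∏ (1 + X ^ i)` turns `∏ (1 - X ^ i)` into `∏ (1 - X ^ (2 * i))`. -/
lemma coeff_prod_mul_gaussBinom {w a b : ℕ} (ha : w ≤ a) (hb : w ≤ b) :
    coeff w ((∏ i ∈ Finset.range a, (1 + (X : ℤ⟦X⟧) ^ (i + 1))) *
      gaussBinom ((X : ℤ⟦X⟧) ^ 2) a b) =
      Fintype.card w.Partition := by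
  refine coeff_eq_card_partition ha _ ?_
  have h : (∏ i ∈ Finset.range a, (1 + (X : ℤ⟦X⟧) ^ (i + 1))) *
      ∏ i ∈ Finset.range a, (1 - X ^ (i + 1)) =
      ∏ i ∈ Finset.range a, (1 - ((X : ℤ⟦X⟧) ^ 2) ^ (i + 1)) := by
    rw [← Finset.prod_mul_distrib]
    exact Finset.prod_congr rfl fun i _ => by ring
  rw [mul_right_comm, h, mul_comm, gaussBinom_mul_prod]
  refine dvd_prod_one_sub_pow_sub_one _ _ _ _ ?_
  rw [← pow_mul]
  exact pow_dvd_pow X (by omega)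

/-! ### Triangular numbers -/

/-- The triangular numbers, indexed without repetition by the integers: `d * (2 * d - 1)`. -/
def triangular (d : ℤ) : ℕ := (d * (2 * d - 1)).toNat

lemma natCast_triangular (d : ℤ) : (triangular d : ℤ) = d * (2 * d - 1) := by
  refine Int.toNat_of_nonneg ?_
  rcases le_or_gt d 0 with h | h
  · exact mul_nonneg_of_nonpos_of_nonpos h (by omega)
  · exact mul_nonneg h.le (by omega)

lemma triangular_injective : Function.Injective triangular := by
  intro d e h
  have h1 : (triangular d : ℤ) = triangular e := by rw [h]
  rw [natCast_triangular, natCast_triangular] at h1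
  have h2 : (d - e) * (2 * (d + e) - 1) = 0 := by linear_combination h1
  rcases mul_eq_zero.mp h2 with h3 | h3 <;> omega

lemma exists_triangular_eq (m : ℕ) : ∃ d : ℤ, m * (m + 1) / 2 = triangular d := by
  rcases Nat.even_or_odd' m with ⟨k, rfl | rfl⟩
  · refine ⟨-k, ?_⟩
    have h : 2 * k * (2 * k + 1) = 2 * (k * (2 * k + 1)) := by ring
    rw [h, Nat.mul_div_cancel_left _ two_pos]
    zify
    rw [natCast_triangular]
    ring
  · refine ⟨k + 1, ?_⟩
    have h : (2 * k + 1) * (2 * k + 1 + 1) = 2 * ((k + 1) * (2 * k + 1)) := by ring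
    rw [h, Nat.mul_div_cancel_left _ two_pos]
    zify
    rw [natCast_triangular]
    ring

/-! ### Generating functions of sets with a statistic -/

section subsetGF

open PowerSeries

/-- The generating function, by the sum of the elements, of the subsets of `A` on which the
statistic `s` takes the value `d`. -/
noncomputable def subsetGF (A : Finset ℕ) (s : Finset ℕ → ℤ) (d : ℤ) : ℤ⟦X⟧ :=
  ∑ S ∈ A.powerset with s S = d, X ^ (∑ x ∈ S, x)

lemma subsetGF_empty (s : Finset ℕ → ℤ) (d : ℤ) :
    subsetGF ∅ s d = if s ∅ = d then 1 else 0 := by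
  simp [subsetGF, Finset.sum_filter]

lemma subsetGF_insert {A : Finset ℕ} {N : ℕ} (hN : N ∉ A) {s : Finset ℕ → ℤ} {d d' : ℤ}
    (h : ∀ S ⊆ A, s (insert N S) = d ↔ s S = d') :
    subsetGF (insert N A) s d = subsetGF A s d + X ^ N * subsetGF A s d' := by
  simp only [subsetGF, Finset.sum_filter, Finset.sum_powerset_insert hN, Finset.mul_sum]
  congr 1
  refine Finset.sum_congr rfl fun S hS => ?_
  rw [Finset.mem_powerset] at hS
  rw [Finset.sum_insert (fun hx => hN (hS hx)), mul_ite, mul_zero, pow_add]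
  simp only [h S hS]

lemma coeff_subsetGF (A : Finset ℕ) (s : Finset ℕ → ℤ) (d : ℤ) (n : ℕ) :
    coeff n (subsetGF A s d) = {S ∈ A.powerset | s S = d ∧ ∑ x ∈ S, x = n}.card := by
  simp only [subsetGF, map_sum, coeff_X_pow, Finset.sum_boole, Finset.filter_filter, eq_comm]

lemma Nat.Partition.nodup_of_mem_distincts {n : ℕ} {p : n.Partition}
    (hp : p ∈ Nat.Partition.distincts n) : p.parts.Nodup := by
  simpa [Nat.Partition.distincts] using hp

/-- Strict partitions of `n` are the sets of positive integers with sum `n`. -/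
lemma ncard_strict_eq_coeff {n : ℕ} (s : Finset ℕ → ℤ) (d : ℤ) {A : Finset ℕ} (h0 : 0 ∉ A)
    (hA : Finset.Icc 1 n ⊆ A) :
    ({p : n.Partition | p ∈ Nat.Partition.distincts n ∧ s p.parts.toFinset = d}.ncard : ℤ) =
      coeff n (subsetGF A s d) := by
  rw [coeff_subsetGF, ← Set.ncard_coe_finset]
  congr 1
  refine Set.ncard_congr (fun p _ => p.parts.toFinset) ?_ ?_ ?_
  · rintro p ⟨hp, hs⟩
    have hnd : p.parts.Nodup := Nat.Partition.nodup_of_mem_distincts hp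
    simp only [Finset.coe_filter, Finset.mem_powerset, Set.mem_ofPred_eq]
    refine ⟨fun x hx => hA ?_, hs, ?_⟩
    · rw [Multiset.mem_toFinset] at hx
      exact Finset.mem_Icc.mpr ⟨p.parts_pos hx, Nat.Partition.le_of_mem_parts hx⟩
    · rw [Finset.sum, Multiset.toFinset_val, hnd.dedup, Multiset.map_id', p.parts_sum]
  · rintro p q ⟨hp, _⟩ ⟨hq, _⟩ h
    have hp' := Nat.Partition.nodup_of_mem_distincts hp
    have hq' := Nat.Partition.nodup_of_mem_distincts hq
    refine Nat.Partition.ext ?_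
    rw [← hp'.dedup, ← hq'.dedup, ← Multiset.toFinset_val, ← Multiset.toFinset_val, h]
  · intro S hS
    simp only [Finset.coe_filter, Finset.mem_powerset, Set.mem_ofPred_eq] at hS
    refine ⟨⟨S.val, fun {i} hi => Nat.pos_of_ne_zero ?_, ?_⟩, ⟨?_, ?_⟩, ?_⟩
    · rintro rfl
      exact h0 (hS.1 hi)
    · rw [← hS.2.2, Finset.sum, Multiset.map_id']
    · simpa [Nat.Partition.distincts] using S.nodup
    · rw [Finset.val_toFinset]
      exact hS.2.1
    · exact Finset.val_toFinset S

lemma X_pow_mul_triangular {N k : ℕ} {d d' b : ℤ} {g : ℤ⟦X⟧} (hg : b < 0 → g = 0)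
    (h : N + d' * (2 * d' - 1) = d * (2 * d - 1) + k * b) :
    X ^ N * (X ^ triangular d' * g) = X ^ triangular d * ((X ^ k) ^ b.toNat * g) := by
  rcases lt_or_ge b 0 with hb | hb
  · simp [hg hb]
  · rw [← mul_assoc, ← mul_assoc, ← pow_add, ← pow_mul, ← pow_add]
    congr 2
    zify
    rw [natCast_triangular, natCast_triangular, Int.toNat_of_nonneg hb, h]

/-- The Pascal rule in the form that matches the removal of the element `N`, the power `X ^ N`
being absorbed by the change from `triangular d'` to `triangular d`. -/
lemma triangular_mul_pascal {N k : ℕ} {d d' a b : ℤ} {g₁ g₂ : ℤ⟦X⟧} (hab : a + b ≠ 0)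
    (hN : N + d' * (2 * d' - 1) = d * (2 * d - 1) + k * b)
    (h₁ : g₁ = gaussBinomInt (X ^ k) a (b - 1)) (h₂ : g₂ = gaussBinomInt (X ^ k) (a - 1) b) :
    X ^ triangular d * g₁ + X ^ N * (X ^ triangular d' * g₂) =
      X ^ triangular d * gaussBinomInt (X ^ k) a b := by
  rw [X_pow_mul_triangular (d := d) (k := k) (b := b)
    (fun hb => by rw [h₂, gaussBinomInt_of_neg _ (Or.inr hb)]) hN, ← mul_add, h₁, h₂,
    ← gaussBinomInt_pascal _ hab]

lemma triangular_mul_pascal' {N k : ℕ} {d d' a b : ℤ} {g₁ g₂ : ℤ⟦X⟧} (hab : a + b ≠ 0)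
    (hN : N + d' * (2 * d' - 1) = d * (2 * d - 1) + k * a)
    (h₁ : g₁ = gaussBinomInt (X ^ k) (a - 1) b) (h₂ : g₂ = gaussBinomInt (X ^ k) a (b - 1)) :
    X ^ triangular d * g₁ + X ^ N * (X ^ triangular d' * g₂) =
      X ^ triangular d * gaussBinomInt (X ^ k) a b := by
  rw [gaussBinomInt_comm _ a b]
  exact triangular_mul_pascal (by rwa [add_comm]) hN (h₁.trans (gaussBinomInt_comm _ _ _))
    (h₂.trans (gaussBinomInt_comm _ _ _))

/-! ### The alternating parity of a strict partition -/

/-- For `l = [x₀, x₁, x₂, …]`, the sum of the `(-1) ^ i` over those `i` for which `xᵢ` is odd. -/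
def altParity : List ℕ → ℤ
  | [] => 0
  | x :: l => (x % 2 : ℕ) - altParity l

/-- The alternating parity of the elements of a finite set, in decreasing order. -/
def altStat (S : Finset ℕ) : ℤ := altParity (S.sort (· ≥ ·))

lemma altStat_insert {S : Finset ℕ} {N : ℕ} (h : ∀ x ∈ S, x < N) :
    altStat (insert N S) = (N % 2 : ℕ) - altStat S := by
  rw [altStat, Finset.sort_insert (· ≥ ·) (fun x hx => (h x hx).le)
    (fun hN => lt_irrefl _ (h N hN)), altParity, altStat]

/-- The sets of positive integers up to `N` with alternating parity `d` are counted by a Gaussian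
binomial coefficient: removing the element `N` corresponds to one of the two Pascal rules, according
to the parity of `N`. -/
lemma subsetGF_altStat (N : ℕ) (d : ℤ) : subsetGF (Finset.Icc 1 N) altStat d =
    X ^ triangular d * gaussBinomInt (X ^ 2) ((N / 2 : ℕ) + d) (N - (N / 2 : ℕ) - d) := by
  induction N generalizing d with
  | zero =>
    rw [Finset.Icc_eq_empty (by simp), subsetGF_empty]
    rcases eq_or_ne d 0 with rfl | hd
    · simp [altStat, altParity, triangular, gaussBinomInt]
    · rw [if_neg (by simpa [altStat, altParity] using hd.symm), gaussBinomInt_of_neg, mul_zero]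
      simp only [Nat.zero_div, Nat.cast_zero]
      omega
  | succ N ih =>
    have hins : Finset.Icc 1 (N + 1) = insert (N + 1) (Finset.Icc 1 N) := by
      ext x
      simp only [Finset.mem_Icc, Finset.mem_insert]
      omega
    have hlt : ∀ S ⊆ Finset.Icc 1 N, ∀ x ∈ S, x < N + 1 := fun S hS x hx =>
      Nat.lt_succ_of_le (Finset.mem_Icc.mp (hS hx)).2
    rw [hins, subsetGF_insert (d' := ((N + 1) % 2 : ℕ) - d) (by simp)
      (fun S hS => by rw [altStat_insert (hlt S hS)]; constructor <;> intro h <;> linarith), ih, ih]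
    rcases Nat.even_or_odd' N with ⟨k, rfl | rfl⟩
    · have e1 : 2 * k / 2 = k := by omega
      have e2 : (2 * k + 1) / 2 = k := by omega
      have e3 : (2 * k + 1) % 2 = 1 := by omega
      rw [e1, e2, e3]
      exact triangular_mul_pascal (by omega) (by push_cast; ring)
        (by congr 1; omega) (by rw [gaussBinomInt_comm]; congr 1 <;> omega)
    · have e1 : (2 * k + 1) / 2 = k := by omega
      have e2 : (2 * k + 1 + 1) / 2 = k + 1 := by omega
      have e3 : (2 * k + 1 + 1) % 2 = 0 := by omega
      rw [e1, e2, e3]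
      exact triangular_mul_pascal' (by omega) (by push_cast; ring)
        (by congr 1 <;> omega) (by rw [gaussBinomInt_comm]; congr 1 <;> omega)

/-! ### The charge of a bead configuration -/

/-- The runner of a position, as a sign: `1` and `-1` on the runners of `1` and of `3`, and `0` on
the leftmost runner. -/
def runnerSign (x : ℕ) : ℤ := if x % 4 = 1 then 1 else if x % 4 = 3 then -1 else 0

/-- The number of beads on the runner of `1` minus the number of beads on the runner of `3`. -/
def charge (S : Finset ℕ) : ℤ := ∑ x ∈ S, runnerSign x

lemma charge_insert {S : Finset ℕ} {N : ℕ} (h : N ∉ S) :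
    charge (insert N S) = runnerSign N + charge S :=
  Finset.sum_insert h

/-- A finite form of Jacobi's triple product: the sets of odd numbers below `2 * K` with charge `d`
are counted by a Gaussian binomial coefficient. -/
lemma subsetGF_charge_odd (K : ℕ) (d : ℤ) :
    subsetGF ((Finset.range K).image (2 * · + 1)) charge d =
      X ^ triangular d * gaussBinomInt (X ^ 4) ((K / 2 : ℕ) + d) (K - (K / 2 : ℕ) - d) := by
  induction K generalizing d with
  | zero =>
    rw [Finset.range_zero, Finset.image_empty, subsetGF_empty]
    rcases eq_or_ne d 0 with rfl | hd
    · simp [charge, triangular, gaussBinomInt]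
    · rw [if_neg (by simpa [charge] using hd.symm), gaussBinomInt_of_neg, mul_zero]
      simp only [Nat.zero_div, Nat.cast_zero]
      omega
  | succ K ih =>
    have hN : 2 * K + 1 ∉ (Finset.range K).image (2 * · + 1) := by simp
    rw [Finset.range_add_one, Finset.image_insert,
      subsetGF_insert (d' := d - runnerSign (2 * K + 1)) hN
      (fun S hS => by rw [charge_insert (fun h => hN (hS h)), eq_sub_iff_add_eq']), ih, ih]
    rcases Nat.even_or_odd' K with ⟨k, rfl | rfl⟩
    · have e1 : 2 * k / 2 = k := by omega
      have e2 : (2 * k + 1) / 2 = k := by omega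
      have e3 : runnerSign (2 * (2 * k) + 1) = 1 := if_pos (by omega)
      rw [e1, e2, e3]
      exact triangular_mul_pascal (by omega) (by push_cast; ring)
        (by congr 1; omega) (by congr 1 <;> omega)
    · have e1 : (2 * k + 1) / 2 = k := by omega
      have e2 : (2 * k + 1 + 1) / 2 = k + 1 := by omega
      have e3 : runnerSign (2 * (2 * k + 1) + 1) = -1 := by
        rw [runnerSign, if_neg (by omega), if_pos (by omega)]
      rw [e1, e2, e3]
      exact triangular_mul_pascal' (by omega) (by push_cast; ring)
        (by congr 1 <;> omega) (by congr 1 <;> omega)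

lemma subsetGF_charge (K M : ℕ) (d : ℤ) :
    subsetGF ((Finset.range M).image (2 * · + 2) ∪ (Finset.range K).image (2 * · + 1)) charge d =
      (∏ i ∈ Finset.range M, (1 + X ^ (2 * i + 2))) *
        (X ^ triangular d * gaussBinomInt (X ^ 4) ((K / 2 : ℕ) + d) (K - (K / 2 : ℕ) - d)) := by
  induction M with
  | zero => simp [subsetGF_charge_odd]
  | succ M ih =>
    have hN : 2 * M + 2 ∉
        (Finset.range M).image (2 * · + 2) ∪ (Finset.range K).image (2 * · + 1) := by
      simp only [Finset.mem_union, Finset.mem_image, Finset.mem_range]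
      omega
    have hs : runnerSign (2 * M + 2) = 0 := by
      rw [runnerSign, if_neg (by omega), if_neg (by omega)]
    rw [Finset.range_add_one, Finset.image_insert, Finset.insert_union,
      subsetGF_insert (d' := d) hN
      (fun S hS => by rw [charge_insert (fun h => hN (hS h)), hs, zero_add]), ih,
      Finset.prod_insert (by simp)]
    ring

/-! ### The two counts -/

lemma coeff_triangular_add (d : ℤ) (w : ℕ) (f : ℤ⟦X⟧) :
    coeff (triangular d + 2 * w) (X ^ triangular d * expand 2 two_ne_zero f) = coeff w f := by
  rw [add_comm, coeff_X_pow_mul, coeff_expand_mul]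

lemma ncard_strict_altStat (w : ℕ) (d : ℤ) :
    {p : (triangular d + 2 * w).Partition | p ∈ Nat.Partition.distincts _ ∧
      altStat p.parts.toFinset = d}.ncard = Fintype.card w.Partition := by
  -- With parts up to `2 * M` the box has sides `M + d` and `M - d`. Choose `M` so large that
  -- every partition of `w` fits into it and that the bound on the parts is no restriction.
  obtain ⟨M, h1, h2, h3⟩ : ∃ M : ℕ, (w : ℤ) ≤ M + d ∧ (w : ℤ) ≤ M - d ∧
      triangular d + 2 * w ≤ 2 * M :=
    ⟨triangular d + 2 * w + d.natAbs, by omega, by omega, by omega⟩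
  obtain ⟨a, ha⟩ : ∃ a : ℕ, (a : ℤ) = M + d := ⟨(M + d).toNat, by omega⟩
  obtain ⟨b, hb⟩ : ∃ b : ℕ, (b : ℤ) = M - d := ⟨(M - d).toNat, by omega⟩
  zify
  rw [ncard_strict_eq_coeff altStat d (A := Finset.Icc 1 (2 * M)) (by simp)
    (Finset.Icc_subset_Icc_right h3), subsetGF_altStat, Nat.mul_div_cancel_left _ two_pos]
  rw [← ha, show ((2 * M : ℕ) : ℤ) - M - d = b by push_cast; omega, gaussBinomInt_natCast,
    ← expand_X 2 two_ne_zero]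
  have := map_gaussBinom (X : ℤ⟦X⟧) (expand 2 two_ne_zero : ℤ⟦X⟧ →ₐ[ℤ] ℤ⟦X⟧).toRingHom a b
  simp only [AlgHom.toRingHom_eq_coe, RingHom.coe_coe] at this
  rw [← this, coeff_triangular_add, coeff_gaussBinom_X (by omega) (by omega)]

lemma ncard_strict_charge (w : ℕ) (d : ℤ) :
    {p : (triangular d + 2 * w).Partition | p ∈ Nat.Partition.distincts _ ∧
      charge p.parts.toFinset = d}.ncard = Fintype.card w.Partition := by
  -- The box again has sides `M + d` and `M - d`; the `M + d` smallest even parts are allowed.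
  obtain ⟨M, h1, h2, h3, h4⟩ : ∃ M : ℕ, (w : ℤ) ≤ M + d ∧ (w : ℤ) ≤ M - d ∧
      triangular d + 2 * w ≤ M ∧ (triangular d + 2 * w : ℕ) ≤ M + d :=
    ⟨triangular d + 2 * w + d.natAbs, by omega, by omega, by omega, by omega⟩
  obtain ⟨a, ha⟩ : ∃ a : ℕ, (a : ℤ) = M + d := ⟨(M + d).toNat, by omega⟩
  obtain ⟨b, hb⟩ : ∃ b : ℕ, (b : ℤ) = M - d := ⟨(M - d).toNat, by omega⟩
  zify
  rw [ncard_strict_eq_coeff charge d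
    (A := (Finset.range a).image (2 * · + 2) ∪ (Finset.range (2 * M)).image (2 * · + 1)) (by simp),
    subsetGF_charge, Nat.mul_div_cancel_left _ two_pos]
  · rw [← ha, show ((2 * M : ℕ) : ℤ) - M - d = b by push_cast; omega, gaussBinomInt_natCast,
      mul_left_comm]
    have h := map_gaussBinom ((X : ℤ⟦X⟧) ^ 2)
      (expand 2 two_ne_zero : ℤ⟦X⟧ →ₐ[ℤ] ℤ⟦X⟧).toRingHom a b
    simp only [AlgHom.toRingHom_eq_coe, RingHom.coe_coe, map_pow, expand_X, ← pow_mul] at h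
    have h' : (∏ i ∈ Finset.range a, (1 + (X : ℤ⟦X⟧) ^ (2 * i + 2))) * gaussBinom (X ^ 4) a b =
        expand 2 two_ne_zero
          ((∏ i ∈ Finset.range a, (1 + (X : ℤ⟦X⟧) ^ (i + 1))) * gaussBinom (X ^ 2) a b) := by
      rw [map_mul, h, map_prod]
      congr 1
      refine Finset.prod_congr rfl fun i _ => ?_
      rw [map_add, map_one, map_pow, expand_X, ← pow_mul]
      congr 2
    rw [h', coeff_triangular_add, coeff_prod_mul_gaussBinom (by omega) (by omega)]
  · intro x hx
    rw [Finset.mem_Icc] at hx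
    simp only [Finset.mem_union, Finset.mem_image, Finset.mem_range]
    rcases Nat.even_or_odd' x with ⟨k, rfl | rfl⟩
    · exact Or.inl ⟨k - 1, by omega, by omega⟩
    · exact Or.inr ⟨k, by omega, rfl⟩

end subsetGF

/-! ### The 2-core of a Young diagram -/

namespace YoungDiagram

/-- The number of cells of even content minus the number of cells of odd content: the checkerboard
colouring, in which each rim 2-hook covers one cell of each colour. -/
def colourSum (μ : YoungDiagram) : ℤ := ∑ c ∈ μ.cells, (-1) ^ (c.1 + c.2)

lemma colourSum_eq_of_removesTwoHook {μ ν : YoungDiagram} (h : RemovesTwoHook μ ν) :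
    μ.colourSum = ν.colourSum := by
  obtain ⟨hle, i, j, h⟩ := h
  rw [colourSum, ← Finset.sum_sdiff (cells_subset_iff.mpr hle), colourSum, add_eq_right]
  rcases h with h | h <;> rw [h, Finset.sum_pair (by simp)] <;> ring

lemma card_eq_of_removesTwoHook {μ ν : YoungDiagram} (h : RemovesTwoHook μ ν) :
    μ.card = ν.card + 2 := by
  obtain ⟨hle, i, j, h⟩ := h
  have h1 := Finset.card_sdiff_add_card_eq_card (cells_subset_iff.mpr hle)
  have h2 : (μ.cells \ ν.cells).card = 2 := by
    rcases h with h | h <;> rw [h, Finset.card_pair (by simp)]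
  change μ.cells.card = ν.cells.card + 2
  omega

lemma colourSum_and_card_of_twoHookReduces {μ ν : YoungDiagram} {w : ℕ}
    (h : TwoHookReduces μ ν w) : μ.colourSum = ν.colourSum ∧ μ.card = ν.card + 2 * w := by
  induction h with
  | refl => simp
  | step h1 _ ih =>
    rw [colourSum_eq_of_removesTwoHook h1, card_eq_of_removesTwoHook h1]
    exact ⟨ih.1, by omega⟩

lemma exists_twoHookReduces_core (μ : YoungDiagram) :
    ∃ (c : YoungDiagram) (w : ℕ), TwoHookReduces μ c w ∧ IsTwoCore c := by
  induction h : μ.card using Nat.strong_induction_on generalizing μ with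
  | _ n ih =>
    by_cases hc : IsTwoCore μ
    · exact ⟨μ, 0, .refl μ, hc⟩
    · simp only [IsTwoCore, not_forall, not_not] at hc
      obtain ⟨ν, hν⟩ := hc
      have := card_eq_of_removesTwoHook hν
      obtain ⟨c, w, h1, h2⟩ := ih _ (by omega) ν rfl
      exact ⟨c, w + 1, .step hν h1, h2⟩

lemma exists_removesTwoHook_horizontal {μ : YoungDiagram} {i j : ℕ} (h : (i, j + 1) ∈ μ)
    (hr : (i, j + 2) ∉ μ) (hd : (i + 1, j) ∉ μ) : ∃ ν, RemovesTwoHook μ ν := by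
  have h' : (i, j) ∈ μ := μ.up_left_mem le_rfl (by omega) h
  refine ⟨⟨μ.cells \ {(i, j), (i, j + 1)}, ?_⟩, ?_, i, j, Or.inl ?_⟩
  · rintro ⟨y1, y2⟩ ⟨x1, x2⟩ ⟨hx1, hx2⟩ hy
    simp only [Finset.coe_sdiff, Set.mem_sdiff, Finset.mem_coe, mem_cells, Finset.mem_insert,
      Finset.mem_singleton, Prod.mk.injEq] at hy hx1 hx2 ⊢
    refine ⟨μ.up_left_mem hx1 hx2 hy.1, fun hx => hy.2 ?_⟩
    have h1 : ¬ (i + 1 ≤ y1 ∧ j ≤ y2) := fun hh => hd (μ.up_left_mem hh.1 hh.2 hy.1)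
    have h2 : ¬ (i ≤ y1 ∧ j + 2 ≤ y2) := fun hh => hr (μ.up_left_mem hh.1 hh.2 hy.1)
    omega
  · exact cells_subset_iff.mp Finset.sdiff_subset
  · refine Finset.sdiff_sdiff_eq_self ?_
    simp [Finset.insert_subset_iff, h, h']

lemma exists_removesTwoHook_vertical {μ : YoungDiagram} {i j : ℕ} (h : (i + 1, j) ∈ μ)
    (hd : (i + 2, j) ∉ μ) (hr : (i, j + 1) ∉ μ) : ∃ ν, RemovesTwoHook μ ν := by
  have h' : (i, j) ∈ μ := μ.up_left_mem (by omega) le_rfl h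
  refine ⟨⟨μ.cells \ {(i, j), (i + 1, j)}, ?_⟩, ?_, i, j, Or.inr ?_⟩
  · rintro ⟨y1, y2⟩ ⟨x1, x2⟩ ⟨hx1, hx2⟩ hy
    simp only [Finset.coe_sdiff, Set.mem_sdiff, Finset.mem_coe, mem_cells, Finset.mem_insert,
      Finset.mem_singleton, Prod.mk.injEq] at hy hx1 hx2 ⊢
    refine ⟨μ.up_left_mem hx1 hx2 hy.1, fun hx => hy.2 ?_⟩
    have h1 : ¬ (i + 2 ≤ y1 ∧ j ≤ y2) := fun hh => hd (μ.up_left_mem hh.1 hh.2 hy.1)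
    have h2 : ¬ (i ≤ y1 ∧ j + 1 ≤ y2) := fun hh => hr (μ.up_left_mem hh.1 hh.2 hy.1)
    omega
  · exact cells_subset_iff.mp Finset.sdiff_subset
  · refine Finset.sdiff_sdiff_eq_self ?_
    simp [Finset.insert_subset_iff, h, h']

lemma rowLen_le_of_isTwoCore {c : YoungDiagram} (hc : IsTwoCore c) (i : ℕ) :
    c.rowLen i ≤ c.rowLen (i + 1) + 1 := by
  by_contra! h
  obtain ⟨ν, hν⟩ := exists_removesTwoHook_horizontal (μ := c) (i := i) (j := c.rowLen i - 2)
    (mem_iff_lt_rowLen.mpr (by omega)) (fun hm => by have := mem_iff_lt_rowLen.mp hm; omega)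
    (fun hm => by have := mem_iff_lt_rowLen.mp hm; omega)
  exact hc ν hν

lemma rowLen_ne_of_isTwoCore {c : YoungDiagram} (hc : IsTwoCore c) {i : ℕ}
    (hi : 0 < c.rowLen i) : c.rowLen i ≠ c.rowLen (i + 1) := by
  intro heq
  -- The last two rows of the block of equal rows end in a removable vertical domino.
  have hex : ∃ k, c.rowLen (i + 1 + (k + 1)) < c.rowLen i := by
    refine ⟨c.colLen 0, ?_⟩
    have : c.rowLen (i + 1 + (c.colLen 0 + 1)) = 0 := by
      by_contra hne
      have := mem_iff_lt_colLen.mp (mem_iff_lt_rowLen.mpr (Nat.pos_of_ne_zero hne))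
      omega
    omega
  classical
  obtain ⟨k, hk, hmin⟩ : ∃ k, c.rowLen (i + 1 + (k + 1)) < c.rowLen i ∧
      c.rowLen i ≤ c.rowLen (i + 1 + k) := by
    refine ⟨Nat.find hex, Nat.find_spec hex, ?_⟩
    rcases hf : Nat.find hex with _ | m
    · exact heq.le
    · exact not_lt.mp (Nat.find_min hex (m := m) (by omega))
  have hanti := c.rowLen_anti i (i + k) (by omega)
  obtain ⟨ν, hν⟩ := exists_removesTwoHook_vertical (μ := c) (i := i + k) (j := c.rowLen i - 1)
    (mem_iff_lt_rowLen.mpr (by rw [show i + k + 1 = i + 1 + k by ring]; omega))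
    (fun hm => by
      have := mem_iff_lt_rowLen.mp hm
      rw [show i + k + 2 = i + 1 + (k + 1) by ring] at this
      omega)
    (fun hm => by have := mem_iff_lt_rowLen.mp hm; omega)
  exact hc ν hν

/-- The 2-cores are the staircases. -/
lemma rowLen_eq_of_isTwoCore {c : YoungDiagram} (hc : IsTwoCore c) (i : ℕ) :
    c.rowLen i = c.rowLen 0 - i := by
  induction i with
  | zero => simp
  | succ i ih =>
    have h1 := rowLen_le_of_isTwoCore hc i
    have h2 := c.rowLen_anti i (i + 1) (by omega)
    rcases Nat.eq_zero_or_pos (c.rowLen i) with h | h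
    · omega
    · have := rowLen_ne_of_isTwoCore hc h
      omega

lemma sum_cells_of_isTwoCore {c : YoungDiagram} (hc : IsTwoCore c) (f : ℕ × ℕ → ℤ) :
    ∑ x ∈ c.cells, f x =
      ∑ i ∈ Finset.range (c.rowLen 0), ∑ j ∈ Finset.range (c.rowLen 0 - i), f (i, j) := by
  refine Finset.sum_finset_product _ _ _ fun p => ?_
  rw [mem_cells, ← Prod.mk.eta (p := p), mem_iff_lt_rowLen, rowLen_eq_of_isTwoCore hc]
  simp only [Finset.mem_range]
  omega

end YoungDiagram

lemma sum_range_neg_one_pow (x : ℕ) : ∑ j ∈ Finset.range x, (-1 : ℤ) ^ j = (x % 2 : ℕ) := by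
  rw [neg_one_geom_sum]
  rcases Nat.even_or_odd x with h | h
  · rw [if_pos h, Nat.even_iff.mp h]; rfl
  · rw [if_neg (Nat.not_even_iff_odd.mpr h), Nat.odd_iff.mp h]; rfl

lemma sum_staircase_succ (f : ℕ × ℕ → ℤ) (m : ℕ) :
    ∑ i ∈ Finset.range (m + 1), ∑ j ∈ Finset.range (m + 1 - i), f (i, j) =
      ∑ i ∈ Finset.range m, ∑ j ∈ Finset.range (m - i), f (i + 1, j) +
        ∑ j ∈ Finset.range (m + 1), f (0, j) := by
  rw [Finset.sum_range_succ']
  simp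

lemma two_mul_colourSum_staircase (m : ℕ) :
    2 * ∑ i ∈ Finset.range m, ∑ j ∈ Finset.range (m - i), (-1 : ℤ) ^ (i + j) =
      if Even m then -(m : ℤ) else m + 1 := by
  induction m with
  | zero => simp
  | succ m ih =>
    rw [sum_staircase_succ (fun x => (-1 : ℤ) ^ (x.1 + x.2))]
    have h : ∀ i j : ℕ, (-1 : ℤ) ^ (i + 1 + j) = -(-1) ^ (i + j) := fun i j => by ring
    simp only [h, Finset.sum_neg_distrib, zero_add, sum_range_neg_one_pow, mul_add, mul_neg, ih]
    rcases Nat.even_or_odd m with hm | hm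
    · have h1 : ¬ Even (m + 1) := by simpa [Nat.even_add_one] using hm
      have h2 : (m + 1) % 2 = 1 := by have := Nat.even_iff.mp hm; omega
      rw [if_pos hm, if_neg h1, h2]
      push_cast; ring
    · have h1 : Even (m + 1) := hm.add_one
      have h2 : (m + 1) % 2 = 0 := by have := Nat.odd_iff.mp hm; omega
      rw [if_neg (Nat.not_even_iff_odd.mpr hm), if_pos h1, h2]
      push_cast; ring

lemma two_mul_card_staircase (m : ℕ) :
    2 * ∑ i ∈ Finset.range m, ∑ _j ∈ Finset.range (m - i), (1 : ℤ) = m * (m + 1) := by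
  induction m with
  | zero => simp
  | succ m ih =>
    rw [sum_staircase_succ (fun _ => (1 : ℤ)), mul_add, ih]
    simp
    ring

/-- A 2-core is determined by its colour sum, and so is its size. -/
lemma YoungDiagram.card_eq_triangular_of_isTwoCore {c : YoungDiagram} (hc : IsTwoCore c) :
    c.card = triangular c.colourSum := by
  have h1 : (2 : ℤ) * c.card = c.rowLen 0 * (c.rowLen 0 + 1) := by
    rw [← two_mul_card_staircase, ← sum_cells_of_isTwoCore hc (fun _ => 1)]
    simp [YoungDiagram.card]
  have h2 : 2 * c.colourSum =
      if Even (c.rowLen 0) then -(c.rowLen 0 : ℤ) else c.rowLen 0 + 1 := by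
    rw [← two_mul_colourSum_staircase, colourSum, sum_cells_of_isTwoCore hc]
  zify
  rw [natCast_triangular]
  suffices h : 2 * (2 * (c.card : ℤ)) = 2 * (2 * (c.colourSum * (2 * c.colourSum - 1))) by omega
  split_ifs at h2
  · linear_combination 2 * h1 - 2 * (2 * c.colourSum - 1 - c.rowLen 0) * h2
  · linear_combination 2 * h1 - 2 * (2 * c.colourSum + c.rowLen 0) * h2

lemma sum_cellsOfRowLens_colour (l : List ℕ) :
    ∑ c ∈ YoungDiagram.cellsOfRowLens l, (-1 : ℤ) ^ (c.1 + c.2) = altParity l := by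
  induction l with
  | nil => rfl
  | cons x l ih =>
    rw [YoungDiagram.cellsOfRowLens, Finset.sum_union, Finset.sum_product, Finset.sum_map,
      altParity, ← ih, ← sum_range_neg_one_pow, sub_eq_add_neg, ← Finset.sum_neg_distrib]
    · congr 1
      · simp
      · refine Finset.sum_congr rfl fun c _ => ?_
        simp only [Function.Embedding.prodMap, Function.Embedding.coeFn_mk, Prod.map,
          Function.Embedding.refl_apply, Nat.succ_eq_add_one]
        ring
    · rw [Finset.disjoint_left]
      rintro ⟨i, j⟩ h1 h2
      simp only [Finset.mem_product, Finset.mem_singleton, Finset.mem_map] at h1 h2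
      obtain ⟨⟨a, b⟩, -, h3⟩ := h2
      have := congrArg Prod.fst h3
      simp [Function.Embedding.prodMap, Prod.map] at this
      omega

lemma card_cellsOfRowLens (l : List ℕ) : (YoungDiagram.cellsOfRowLens l).card = l.sum := by
  induction l with
  | nil => rfl
  | cons x l ih =>
    rw [YoungDiagram.cellsOfRowLens, Finset.card_union_of_disjoint, Finset.card_product,
      Finset.card_map, ih]
    · simp
    · rw [Finset.disjoint_left]
      rintro ⟨i, j⟩ h1 h2
      simp only [Finset.mem_product, Finset.mem_singleton, Finset.mem_map] at h1 h2
      obtain ⟨⟨a, b⟩, -, h3⟩ := h2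
      have := congrArg Prod.fst h3
      simp [Function.Embedding.prodMap, Prod.map] at this
      omega

lemma Nat.Partition.card_youngDiagram {n : ℕ} (p : n.Partition) : p.youngDiagram.card = n := by
  change (YoungDiagram.cellsOfRowLens _).card = n
  rw [card_cellsOfRowLens, ← Multiset.sum_coe, Multiset.sort_eq, p.parts_sum]

lemma Nat.Partition.colourSum_youngDiagram {n : ℕ} (p : n.Partition) (hp : p.parts.Nodup) :
    p.youngDiagram.colourSum = altStat p.parts.toFinset := by
  change ∑ c ∈ YoungDiagram.cellsOfRowLens _, _ = _
  rw [sum_cellsOfRowLens_colour, altStat, ← Finset.sort_val, Multiset.toFinset_val, hp.dedup]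

lemma Nat.Partition.hasTwoWeight_iff {d : ℤ} {w : ℕ} (p : (triangular d + 2 * w).Partition) :
    p.HasTwoWeight w ↔ p.youngDiagram.colourSum = d := by
  have hcard := p.card_youngDiagram
  constructor
  · rintro ⟨c, hred, hc⟩
    obtain ⟨h1, h2⟩ := YoungDiagram.colourSum_and_card_of_twoHookReduces hred
    have h3 := YoungDiagram.card_eq_triangular_of_isTwoCore hc
    rw [h1]
    exact triangular_injective (by omega)
  · intro hd
    obtain ⟨c, w', hred, hc⟩ := p.youngDiagram.exists_twoHookReduces_core
    obtain ⟨h1, h2⟩ := YoungDiagram.colourSum_and_card_of_twoHookReduces hred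
    have h3 := YoungDiagram.card_eq_triangular_of_isTwoCore hc
    rw [← h1, hd] at h3
    obtain rfl : w' = w := by omega
    exact ⟨c, hred, hc⟩

/-! ### The H-core of a bead configuration -/

lemma sum_insert_erase_add {S : Finset ℕ} {a b : ℕ} (hb : b ∈ S) (ha : a ∉ S) {M : Type*}
    [AddCommMonoid M] (f : ℕ → M) :
    ∑ x ∈ insert a (S.erase b), f x + f b = ∑ x ∈ S, f x + f a := by
  rw [Finset.sum_insert (fun h => ha (Finset.mem_of_mem_erase h)), add_assoc,
    Finset.sum_erase_add _ _ hb, add_comm]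

lemma runnerSign_of_even {a : ℕ} (h : Even a) : runnerSign a = 0 := by
  have := Nat.even_iff.mp h
  rw [runnerSign, if_neg (by omega), if_neg (by omega)]

lemma runnerSign_add_four (a : ℕ) : runnerSign (a + 4) = runnerSign a := by
  simp [runnerSign]

lemma zero_notMem_of_hMove {S T : Finset ℕ} {k : ℕ} (h : HMove S T k) (h0 : 0 ∉ S) : 0 ∉ T := by
  cases h with
  | evenUp a ha => simp [h0, ha.ne]
  | removeTwo => simp [h0]
  | oddUp a ha => simp [h0, ha.pos.ne]
  | removePair => simp [h0]

lemma charge_eq_of_hMove {S T : Finset ℕ} {k : ℕ} (h : HMove S T k) : charge S = charge T := by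
  cases h with
  | evenUp a _ ha hs hf =>
    have := sum_insert_erase_add hs hf runnerSign
    rw [runnerSign_of_even ha, runnerSign_of_even (ha.add even_two), add_zero, add_zero] at this
    exact this.symm
  | removeTwo hs =>
    have := Finset.add_sum_erase S runnerSign hs
    rw [runnerSign_of_even even_two, zero_add] at this
    exact this.symm
  | oddUp a ha hs hf =>
    have := sum_insert_erase_add hs hf runnerSign
    rw [runnerSign_add_four, add_left_inj] at this
    exact this.symm
  | removePair h1 h3 =>
    have h3' : 3 ∈ S.erase 1 := Finset.mem_erase.mpr ⟨by simp, h3⟩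
    rw [charge, charge, ← Finset.add_sum_erase S runnerSign h1,
      ← Finset.add_sum_erase (S.erase 1) runnerSign h3']
    simp [runnerSign]

lemma sum_eq_of_hMove {S T : Finset ℕ} {k : ℕ} (h : HMove S T k) :
    ∑ x ∈ S, x = ∑ x ∈ T, x + 2 * k := by
  cases h with
  | evenUp a _ ha hs hf =>
    have := sum_insert_erase_add hs hf id
    simp only [id] at this
    omega
  | removeTwo hs =>
    have := Finset.add_sum_erase S id hs
    simp only [id] at this
    omega
  | oddUp a ha hs hf =>
    have := sum_insert_erase_add hs hf id
    simp only [id] at this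
    omega
  | removePair h1 h3 =>
    have h3' : 3 ∈ S.erase 1 := Finset.mem_erase.mpr ⟨by simp, h3⟩
    have e1 := Finset.add_sum_erase S id h1
    have e2 := Finset.add_sum_erase (S.erase 1) id h3'
    simp only [id] at e1 e2
    omega

lemma pos_of_hMove {S T : Finset ℕ} {k : ℕ} (h : HMove S T k) : 0 < k := by
  cases h <;> simp

lemma invariants_of_hReduces {S T : Finset ℕ} {w : ℕ} (h : HReduces S T w) (h0 : 0 ∉ S) :
    0 ∉ T ∧ charge S = charge T ∧ ∑ x ∈ S, x = ∑ x ∈ T, x + 2 * w := by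
  induction h with
  | refl => exact ⟨h0, rfl, rfl⟩
  | step h1 _ ih =>
    obtain ⟨h2, h3, h4⟩ := ih (zero_notMem_of_hMove h1 h0)
    refine ⟨h2, (charge_eq_of_hMove h1).trans h3, ?_⟩
    rw [sum_eq_of_hMove h1, h4]
    ring

lemma exists_hReduces_core (S : Finset ℕ) :
    ∃ (C : Finset ℕ) (w : ℕ), HReduces S C w ∧ IsHCore C := by
  induction h : ∑ x ∈ S, x using Nat.strong_induction_on generalizing S with
  | _ n ih =>
    by_cases hc : IsHCore S
    · exact ⟨S, 0, .refl S, hc⟩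
    · simp only [IsHCore, not_forall, not_not] at hc
      obtain ⟨T, k, hT⟩ := hc
      have h1 := sum_eq_of_hMove hT
      have h2 := pos_of_hMove hT
      obtain ⟨C, w, h3, h4⟩ := ih _ (by omega) T rfl
      exact ⟨C, k + w, .step hT h3, h4⟩

lemma odd_of_mem_isHCore {C : Finset ℕ} (hC : IsHCore C) (h0 : 0 ∉ C) {x : ℕ} (hx : x ∈ C) :
    Odd x := by
  induction x using Nat.strong_induction_on with
  | _ x ih =>
    by_contra hodd
    rw [Nat.not_odd_iff_even] at hodd
    have hx0 : x ≠ 0 := fun h => h0 (h ▸ hx)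
    obtain ⟨k, hk⟩ := hodd
    obtain ⟨y, rfl⟩ : ∃ y, x = y + 2 := ⟨x - 2, by omega⟩
    have hy : Even y := ⟨k - 1, by omega⟩
    rcases Nat.eq_zero_or_pos y with rfl | hpos
    · exact hC _ _ (.removeTwo C hx)
    · by_cases hyC : y ∈ C
      · exact Nat.not_odd_iff_even.mpr hy (ih y (by omega) hyC)
      · exact hC _ _ (.evenUp C y hpos hy hx hyC)

/-- In an H-core the beads on an odd runner fill an initial segment of the runner. -/
lemma exists_runner_of_isHCore {C : Finset ℕ} (hC : IsHCore C) {r : ℕ} (hr : Odd r) :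
    ∃ k, ∀ i, 4 * i + r ∈ C ↔ i < k := by
  have hdown : ∀ i, 4 * (i + 1) + r ∈ C → 4 * i + r ∈ C := by
    intro i hi
    by_contra h
    refine hC _ _ (.oddUp C (4 * i + r) ?_ ?_ h)
    · rw [show 4 * i + r = 2 * (2 * i) + r by ring]
      exact (even_two_mul _).add_odd hr
    · rwa [show 4 * i + r + 4 = 4 * (i + 1) + r by ring]
  have hex : ∃ k, 4 * k + r ∉ C := by
    obtain ⟨b, hb⟩ := C.bddAbove
    exact ⟨b + 1, fun h => by have := hb h; omega⟩
  classical
  refine ⟨Nat.find hex, fun i => ⟨fun hi => ?_, fun hi => not_not.mp (Nat.find_min hex hi)⟩⟩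
  by_contra! hle
  have hall : ∀ j, Nat.find hex ≤ j → 4 * j + r ∉ C := by
    intro j hj
    induction j, hj using Nat.le_induction with
    | base => exact Nat.find_spec hex
    | succ j _ ih => exact fun h => ih (hdown j h)
  exact hall i hle hi

lemma sum_range_four_mul_add (k r : ℕ) :
    (∑ i ∈ Finset.range k, ((4 * i + r : ℕ) : ℤ)) = k * (2 * k - 2 + r) := by
  induction k with
  | zero => simp
  | succ k ih =>
    rw [Finset.sum_range_succ, ih]
    push_cast
    ring

/-- An H-core is determined by its charge: it consists of the first `d` positions of the runner of
`1` if `d ≥ 0`, and of the first `-d` positions of the runner of `3` otherwise. -/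
lemma sum_eq_triangular_of_isHCore {C : Finset ℕ} (hC : IsHCore C) (h0 : 0 ∉ C) :
    ∑ x ∈ C, x = triangular (charge C) := by
  obtain ⟨k, hk⟩ := exists_runner_of_isHCore hC (r := 1) odd_one
  obtain ⟨l, hl⟩ := exists_runner_of_isHCore hC (r := 3) (by decide)
  have hkl : k = 0 ∨ l = 0 := by
    by_contra! h
    exact hC _ _ (.removePair C ((hk 0).mpr (by omega)) ((hl 0).mpr (by omega)))
  have hsum : ∀ f : ℕ → ℤ, ∑ x ∈ C, f x =
      ∑ i ∈ Finset.range k, f (4 * i + 1) + ∑ i ∈ Finset.range l, f (4 * i + 3) := by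
    intro f
    have hCeq : C = (Finset.range k).image (4 * · + 1) ∪ (Finset.range l).image (4 * · + 3) := by
      ext x
      simp only [Finset.mem_union, Finset.mem_image, Finset.mem_range]
      constructor
      · intro hx
        have hodd := Nat.odd_iff.mp (odd_of_mem_isHCore hC h0 hx)
        rcases (by omega : x = 4 * (x / 4) + 1 ∨ x = 4 * (x / 4) + 3) with h | h
        · exact Or.inl ⟨x / 4, (hk _).mp (h ▸ hx), h.symm⟩
        · exact Or.inr ⟨x / 4, (hl _).mp (h ▸ hx), h.symm⟩
      · rintro (⟨i, hi, rfl⟩ | ⟨i, hi, rfl⟩)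
        · exact (hk i).mpr hi
        · exact (hl i).mpr hi
    rw [hCeq, Finset.sum_union, Finset.sum_image, Finset.sum_image]
    · intro a _ b _ h
      simpa using h
    · intro a _ b _ h
      simpa using h
    · rw [Finset.disjoint_left]
      simp only [Finset.mem_image, Finset.mem_range]
      omega
  have h1 : ∀ i, runnerSign (4 * i + 1) = 1 := fun i => if_pos (by omega)
  have h3 : ∀ i, runnerSign (4 * i + 3) = -1 := fun i => by
    rw [runnerSign, if_neg (by omega), if_pos (by omega)]
  have hcharge : charge C = k - l := by
    rw [charge, hsum]
    simp [h1, h3, sub_eq_add_neg]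
  zify
  rw [natCast_triangular, hcharge, hsum, sum_range_four_mul_add, sum_range_four_mul_add]
  rcases hkl with rfl | rfl <;> push_cast <;> ring

lemma Nat.Partition.hasHWeight_iff {d : ℤ} {w : ℕ} (p : (triangular d + 2 * w).Partition)
    (hp : p.parts.Nodup) : p.HasHWeight w ↔ charge p.parts.toFinset = d := by
  have h0 : 0 ∉ p.hAbacus := fun h => (p.parts_pos (Multiset.mem_toFinset.mp h)).ne rfl
  have hsum : ∑ x ∈ p.hAbacus, x = triangular d + 2 * w := by
    rw [hAbacus, Finset.sum, Multiset.toFinset_val, hp.dedup, Multiset.map_id', p.parts_sum]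
  change _ ↔ charge p.hAbacus = d
  constructor
  · rintro ⟨C, hred, hC⟩
    obtain ⟨h1, h2, h3⟩ := invariants_of_hReduces hred h0
    have h4 := sum_eq_triangular_of_isHCore hC h1
    rw [h2]
    exact triangular_injective (by omega)
  · intro hd
    obtain ⟨C, w', hred, hC⟩ := exists_hReduces_core p.hAbacus
    obtain ⟨h1, h2, h3⟩ := invariants_of_hReduces hred h0
    have h4 := sum_eq_triangular_of_isHCore hC h1
    rw [← h2, hd] at h4
    obtain rfl : w' = w := by omega
    exact ⟨C, hred, hC⟩

/-! ### The count of strict partitions by their weights -/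

theorem mainTheorem2 (n w : ℕ) (h : ∃ m : ℕ, n = 2 * w + m * (m + 1) / 2) :
    (strictTwoWeight n w).ncard = (strictHWeight n w).ncard ∧
      (strictHWeight n w).ncard = Fintype.card w.Partition := by
  obtain ⟨m, hm⟩ := h
  obtain ⟨d, hd⟩ := exists_triangular_eq m
  obtain rfl : n = triangular d + 2 * w := by omega
  have h2 : strictTwoWeight (triangular d + 2 * w) w =
      {p | p ∈ Nat.Partition.distincts _ ∧ altStat p.parts.toFinset = d} := by
    ext p
    refine and_congr_right fun hp => ?_
    rw [p.hasTwoWeight_iff, p.colourSum_youngDiagram (Nat.Partition.nodup_of_mem_distincts hp)]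
  have hH : strictHWeight (triangular d + 2 * w) w =
      {p | p ∈ Nat.Partition.distincts _ ∧ charge p.parts.toFinset = d} := by
    ext p
    exact and_congr_right fun hp => p.hasHWeight_iff (Nat.Partition.nodup_of_mem_distincts hp)
  rw [h2, hH, ncard_strict_altStat, ncard_strict_charge]
  exact ⟨rfl, rfl⟩
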